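/- Let $n\ge 0$. For a subset $X\subseteq\mathbb{R}^{n+1}$, a line bundle $\mathscr{L}$ over $X$ is given by a continuous map $\varphi$ from $X$ to the real projective space $\mathbb{P}^{n}$ of lines through $0$ in $\mathbb{R}^{n+1}$; it is the set $\mathscr{L}=\{(x,u) : x\in X,\ u\in\varphi(x)\}\subseteq\mathbb{R}^{n+1}\times\mathbb{R}^{n+1}$. Write $\Delta_*\mathscr{L}=\{x+u : (x,u)\in\mathscr{L}\}=\bigcup_{x\in X}(x+\varphi(x))$. (1) For every sphere $S=\{x\in\mathbb{R}^{n+1} : \|x-c\|=R\}$ with $c\in\mathbb{R}^{n+1}$ and $R>0$, and every line bundle $\mathscr{L}$ over $S$, the set $\Delta_*\mathscr{L}$ has non-empty interior in $\mathbb{R}^{n+1}$. If moreover $n\ge 1$ and $\mathscr{L}$ is tangent to $S$, that is, $\varphi(x)\perp x-c$ for all $x\in S$, then $\Delta_*\mathscr{L}=\{x\in\mathbb{R}^{n+1} : \|x-c\|\ge R\}$, the complement of the open ball bounded by $S$. (2) For every ellipsoid $X=\{x\in\mathbb{R}^{n+1} : Q(x-c)=r\}$, where $Q$ is a positive definite quadratic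 form on $\mathbb{R}^{n+1}$, $c\in\mathbb{R}^{n+1}$ and $r>0$, and every line bundle $\mathscr{L}$ over $X$, the set $\Delta_*\mathscr{L}$ has non-empty interior in $\mathbb{R}^{n+1}$. -/

import Mathlib

open scoped LinearAlgebra.Projectivization

/-- The usual topology of the projective space of a real topological vector space: the quotient
topology coming from the nonzero vectors. -/
noncomputable instance projectivizationTopology (V : Type*) [AddCommGroup V] [Module ℝ V]
    [TopologicalSpace V] : TopologicalSpace (ℙ ℝ V) :=
  TopologicalSpace.coinduced (Projectivization.mk' ℝ : {v : V // v ≠ 0} → ℙ ℝ V) inferInstance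

/-- A (continuous, embedded) line bundle over a subset `X` of `V`: it is given by a continuous map
from `X` (with the subspace topology) to the projective space of lines through `0` in `V`. -/
structure EmbeddedLineBundle {V : Type*} [AddCommGroup V] [Module ℝ V] [TopologicalSpace V]
    (X : Set V) where
  /-- The classifying map. -/
  toFun : X → ℙ ℝ V
  continuous_toFun : Continuous toFun

namespace EmbeddedLineBundle

variable {V : Type*} [AddCommGroup V] [Module ℝ V] [TopologicalSpace V] {X : Set V}

/-- The total space `{(x, u) | x ∈ X, u ∈ φ(x)}` as a subset of `V × V`: the pullback of the
tautological bundle along the classifying map `φ`. -/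
def totalSpace (L : EmbeddedLineBundle X) : Set (V × V) :=
  {q | ∃ x : X, q.1 = x ∧ q.2 ∈ (L.toFun x).submodule}

end EmbeddedLineBundle

/-- The codiagonal map `V × V → V`, `(x, y) ↦ x + y`. -/
def codiagonal {V : Type*} [AddCommGroup V] (q : V × V) : V := q.1 + q.2

/-- The tangent space at `p` of the sphere with centre `c` through `p`, as a linear subspace. -/
noncomputable def sphereTangentSpace {n : ℕ} (c p : EuclideanSpace ℝ (Fin (n + 1))) :
    Submodule ℝ (EuclideanSpace ℝ (Fin (n + 1))) :=
  (Submodule.span ℝ {p - c})ᗮ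

/-- A line bundle over the sphere with centre `c` and radius `R` is tangent to the sphere if each
of its fibres lies in the tangent space of the sphere at the base point. -/
def EmbeddedLineBundle.IsTangentToSphere {n : ℕ} {c : EuclideanSpace ℝ (Fin (n + 1))} {R : ℝ}
    (L : EmbeddedLineBundle (Metric.sphere c R)) : Prop :=
  ∀ p : Metric.sphere c R,
    (L.toFun p).submodule ≤ sphereTangentSpace c (p : EuclideanSpace ℝ (Fin (n + 1)))

/-- An `n`-dimensional ellipsoid in `ℝⁿ⁺¹`, with arbitrary centre: a (nonempty) regular level set
of a positive definite quadratic form, up to translation. -/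
def IsEllipsoid {n : ℕ} (X : Set (EuclideanSpace ℝ (Fin (n + 1)))) : Prop :=
  ∃ (Q : QuadraticForm ℝ (EuclideanSpace ℝ (Fin (n + 1))))
    (c : EuclideanSpace ℝ (Fin (n + 1))) (r : ℝ),
    Q.PosDef ∧ 0 < r ∧ X = {x | Q (x - c) = r}

/-! A point `y` missed by all the lines means that the field `x - y` on the hypersurface never lies
in `φ(x)`. If `f` is a nowhere vanishing section of the bundle, the segment from `x - y` to `f(x)`
then avoids `0`, so all fields `x - y` with `y` missed are homotopic to `f` in the punctured space.
If the swept set had empty interior, some `y` near the centre and some `z` far away would both be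
missed. But `x - y` is homotopic to the inclusion of the sphere, while `x - z` is nullhomotopic: a
contradiction, as the sphere is not contractible in the punctured space. For a tangent bundle the
centre itself is missed, so no exterior `z` can be. An ellipsoid is a radial graph over the sphere.

Two inputs remain: the existence of `f` (`exists_section_of_avoids`) and non-contractibility
(`not_nullhomotopic_sphereInclusion`), which rests on an analytic no-retraction theorem proved by
comparing volumes. -/

/-! ### No `C¹` retraction of the ball onto the sphere. -/

section NoRetraction

open Metric MeasureTheory Polynomial

variable {V : Type*} [NormedAddCommGroup V] [InnerProductSpace ℝ V] [FiniteDimensional ℝ V]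

/-- `t ↦ det (1 + t A)` is a polynomial function of degree at most the dimension. -/
theorem exists_polynomial_eval_eq_det_one_add_smul (A : V →L[ℝ] V) :
    ∃ p : ℝ[X], p.natDegree ≤ Module.finrank ℝ V ∧
      ∀ t : ℝ, (1 + t • A : V →L[ℝ] V).det = p.eval t := by
  let b := Module.finBasis ℝ V
  let M := LinearMap.toMatrix b b (A : V →ₗ[ℝ] V)
  refine ⟨((X : ℝ[X]) • M.map C + (1 : Matrix _ _ ℝ).map C).det, ?_, fun t => ?_⟩
  · simpa using natDegree_det_X_add_C_le M 1
  · rw [ContinuousLinearMap.det, ← LinearMap.det_toMatrix b, ← coe_evalRingHom, RingHom.map_det]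
    congr 1
    have : ((1 + t • A : V →L[ℝ] V) : V →ₗ[ℝ] V) = 1 + t • (A : V →ₗ[ℝ] V) := rfl
    rw [this, map_add, map_smul, LinearMap.toMatrix_one]
    ext i j
    simp [M, Matrix.one_apply, apply_ite, add_comm, mul_comm t]

/-- Values at `1` of polynomials of degree less than `m` are a fixed affine combination of the
values at `m` given distinct nodes. -/
theorem exists_sum_eval_eq_eval_one {m : ℕ} (hm : 0 < m) (v : ℕ → ℝ) (hv : Function.Injective v) :
    ∃ c : ℕ → ℝ, (∑ i ∈ Finset.range m, c i = 1) ∧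
      ∀ p : ℝ[X], p.natDegree < m → p.eval 1 = ∑ i ∈ Finset.range m, c i * p.eval (v i) := by
  have key : ∀ p : ℝ[X], p.natDegree < m → p.eval 1 = ∑ i ∈ Finset.range m,
      (Lagrange.basis (Finset.range m) v i).eval 1 * p.eval (v i) := by
    intro p hp
    have h := Lagrange.eq_interpolate (s := Finset.range m) (f := p) hv.injOn
      (by simpa using (degree_lt_iff_coeff_zero p m).2 fun k hk =>
        coeff_eq_zero_of_natDegree_lt (hp.trans_le hk))
    conv_lhs => rw [h]
    simp [Lagrange.interpolate_apply, eval_finsetSum, mul_comm]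
  refine ⟨_, ?_, key⟩
  -- The constant polynomial `1` shows that the weights sum to `1`.
  have h := key 1 (by simpa using hm)
  simpa using h.symm

/-- A map of norm one has singular derivative. -/
theorem det_fderiv_eq_zero_of_norm_eq_one {r : V → V} {x : V} (hr : DifferentiableAt ℝ r x)
    (h1 : ∀ x, ‖r x‖ = 1) : (fderiv ℝ r x).det = 0 := by
  by_contra h
  have hsurj : Function.Surjective (fderiv ℝ r x) := by
    have := (LinearMap.isUnit_iff_isUnit_det (fderiv ℝ r x : V →ₗ[ℝ] V)).2 (isUnit_iff_ne_zero.2 h)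
    exact ((Module.End.isUnit_iff _).1 this).2
  -- Differentiating `‖r‖² = 1` in a direction `w` that the derivative sends to `r x` gives `2 = 0`.
  obtain ⟨w, hw⟩ := hsurj (r x)
  have h2 : HasFDerivAt (fun y => inner ℝ (r y) (r y)) _ x := hr.hasFDerivAt.inner ℝ hr.hasFDerivAt
  have h3 : (fun y => inner ℝ (r y) (r y)) = fun _ => (1 : ℝ) := by
    ext y; rw [real_inner_self_eq_norm_sq, h1]; norm_num
  rw [h3] at h2
  have h4 := congrArg (fun L : V →L[ℝ] ℝ => L w) (h2.unique (hasFDerivAt_const (1 : ℝ) x))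
  simp [hw, h1] at h4

/-- For small `t > 0`, a perturbation `x ↦ x + t g x` of the identity which preserves the unit ball
and fixes the unit sphere maps the open unit ball onto itself. -/
theorem image_ball_eq_of_perturbation {g : V → V} {K : NNReal} {t : ℝ} (ht : 0 ≤ t)
    (hK : LipschitzOnWith K g (closedBall 0 1)) (htK : t * K < 1)
    (hs : ∀ x ∈ sphere (0 : V) 1, g x = 0)
    (hb : ∀ x ∈ ball (0 : V) 1, x + t • g x ∈ ball (0 : V) 1) :
    Set.InjOn (fun x => x + t • g x) (ball 0 1) ∧
      (fun x => x + t • g x) '' ball (0 : V) 1 = ball 0 1 := by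
  set h : V → V := fun x => x + t • g x with hdef
  have happ : ApproximatesLinearOn h ((ContinuousLinearEquiv.refl ℝ V : V ≃L[ℝ] V) : V →L[ℝ] V)
      (ball 0 1) (t.toNNReal * K) := by
    intro x hx y hy
    have : h x - h y - (x - y) = t • (g x - g y) := by simp only [hdef, smul_sub]; abel
    have h2 := hK.norm_sub_le (ball_subset_closedBall hx) (ball_subset_closedBall hy)
    simp only [ContinuousLinearEquiv.coe_refl, ContinuousLinearMap.coe_id', id, this, norm_smul,
      Real.norm_of_nonneg ht, NNReal.coe_mul, Real.coe_toNNReal t ht, mul_assoc]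
    gcongr
  have hc : Subsingleton V ∨ t.toNNReal * K <
      ‖((ContinuousLinearEquiv.refl ℝ V).symm : V →L[ℝ] V)‖₊⁻¹ := by
    rcases subsingleton_or_nontrivial V with hV | hV
    · exact Or.inl hV
    · right
      have : ‖((ContinuousLinearEquiv.refl ℝ V).symm : V →L[ℝ] V)‖₊ = 1 := by
        simp [ContinuousLinearEquiv.refl_symm]
      rw [this, inv_one, ← NNReal.coe_lt_coe]
      simpa [ht] using htK
  have hopen : IsOpen (h '' ball 0 1) := by
    have := (happ.toOpenPartialHomeomorph h _ hc isOpen_ball).open_target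
    rwa [ApproximatesLinearOn.toOpenPartialHomeomorph_target] at this
  refine ⟨happ.injOn hc, Set.Subset.antisymm (Set.image_subset_iff.2 hb) ?_⟩
  have hcont : ContinuousOn h (closedBall 0 1) :=
    continuousOn_id.add (hK.continuousOn.const_smul t)
  have hclosed : IsClosed (h '' closedBall 0 1) :=
    ((isCompact_closedBall (0 : V) 1).image_of_continuousOn hcont).isClosed
  -- The image is open, and relatively closed in the connected ball: a limit is `h x` with `‖x‖ ≤
  -- 1`, and `‖x‖ = 1` is excluded because `h` fixes the sphere.
  refine (convex_ball (0 : V) 1).isPreconnected.subset_of_closure_inter_subset hopen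
    ⟨h 0, hb 0 (by simp), Set.mem_image_of_mem _ (by simp)⟩ ?_
  rintro y ⟨hy, hy1⟩
  obtain ⟨x, hx, rfl⟩ :=
    closure_minimal (Set.image_mono ball_subset_closedBall) hclosed hy
  refine ⟨x, ?_, rfl⟩
  by_contra hx2
  have hx3 : x ∈ sphere (0 : V) 1 := by
    simp only [mem_closedBall, mem_ball, not_lt, mem_sphere] at hx hx2 ⊢
    exact le_antisymm hx hx2
  rw [hdef] at hy1
  simp only [hs x hx3, smul_zero, add_zero] at hy1
  exact hx2 hy1

/-- There is no `C¹` retraction of the unit ball onto the unit sphere. -/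
theorem not_exists_contDiff_retraction {r : V → V} (hr : ContDiff ℝ 1 r)
    (hs : ∀ x ∈ sphere (0 : V) 1, r x = x) (h1 : ∀ x, ‖r x‖ = 1) : False := by
  borelize V
  have hrd : Differentiable ℝ r := hr.differentiable one_ne_zero
  set g : V → V := fun x => r x - x with hg
  have hgc : ContDiff ℝ 1 g := hr.sub contDiff_id
  have hgd : Differentiable ℝ g := hgc.differentiable one_ne_zero
  have hg' : Continuous (fderiv ℝ g) := hgc.continuous_fderiv one_ne_zero
  obtain ⟨K, hK⟩ : ∃ K : ℝ, ∀ x ∈ closedBall (0 : V) 1, ‖fderiv ℝ g x‖ ≤ K :=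
    (isCompact_closedBall (0 : V) 1).exists_bound_of_continuousOn hg'.continuousOn
  have hK0 : 0 ≤ K := (norm_nonneg _).trans (hK 0 (by simp))
  have hlip : LipschitzOnWith ⟨K, hK0⟩ g (closedBall 0 1) :=
    (convex_closedBall (0 : V) 1).lipschitzOnWith_of_nnnorm_fderiv_le (𝕜 := ℝ)
      (fun x _ => hgd x) hK
  -- Positivity near the identity removes the absolute value from the change of variables for small
  -- `t`.
  obtain ⟨δ, hδ, hdet⟩ : ∃ δ > 0, ∀ A : V →L[ℝ] V, dist A 1 < δ → 0 < A.det := by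
    have hc : ContinuousAt (fun A : V →L[ℝ] V => A.det) 1 :=
      ContinuousLinearMap.continuous_det.continuousAt
    have : (0 : ℝ) < (1 : V →L[ℝ] V).det := by
      have h : (1 : V →L[ℝ] V).det = 1 := LinearMap.det_id
      rw [h]; exact one_pos
    exact Metric.eventually_nhds_iff.1 (hc.eventually (lt_mem_nhds this))
  let F : ℝ → V → ℝ := fun t x => (1 + t • fderiv ℝ g x : V →L[ℝ] V).det
  have hFc : ∀ t, Continuous (F t) := fun t =>
    ContinuousLinearMap.continuous_det.comp (continuous_const.add (hg'.const_smul t))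
  have hFi : ∀ t, IntegrableOn (F t) (ball 0 1) := fun t =>
    ((hFc t).continuousOn.integrableOn_compact (isCompact_closedBall 0 1)).mono_set
      ball_subset_closedBall
  have hvol : ∀ t, 0 < t → t < 1 → t * K < 1 → t * K < δ →
      ∫ x in ball (0 : V) 1, F t x = volume.real (ball (0 : V) 1) := by
    intro t ht0 ht1 htK htδ
    obtain ⟨hinj, himg⟩ := image_ball_eq_of_perturbation ht0.le hlip htK
      (fun x hx => by simp [hg, hs x hx]) (fun x hx => by
        have h2 : x + t • g x = (1 - t) • x + t • r x := by
          simp only [hg, smul_sub, sub_smul, one_smul]; abel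
        rw [mem_ball_zero_iff] at hx ⊢
        rw [h2]
        refine (norm_add_le _ _).trans_lt ?_
        rw [norm_smul, norm_smul, h1, Real.norm_of_nonneg ht0.le,
          Real.norm_of_nonneg (sub_pos.2 ht1).le]
        nlinarith)
    have hd : ∀ x ∈ ball (0 : V) 1, HasFDerivWithinAt (fun x => x + t • g x)
        (1 + t • fderiv ℝ g x) (ball 0 1) x := fun x _ =>
      ((hasFDerivAt_id x).add ((hgd x).hasFDerivAt.const_smul t)).hasFDerivWithinAt
    have h3 := integral_image_eq_integral_abs_det_fderiv_smul volume measurableSet_ball hd hinj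
      (fun _ => (1 : ℝ))
    rw [himg] at h3
    simp only [smul_eq_mul, mul_one, setIntegral_const] at h3
    rw [h3]
    refine setIntegral_congr_fun measurableSet_ball fun x hx => (abs_of_pos ?_).symm
    refine hdet _ ?_
    rw [dist_eq_norm, add_sub_cancel_left, norm_smul, Real.norm_of_nonneg ht0.le]
    exact (mul_le_mul_of_nonneg_left (hK x (ball_subset_closedBall hx)) ht0.le).trans_lt htδ
  obtain ⟨ε, hε0, hε⟩ : ∃ ε : ℝ, 0 < ε ∧ ∀ t, 0 < t → t ≤ ε → t < 1 ∧ t * K < 1 ∧ t * K < δ := by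
    have hm : 0 < min 1 δ := lt_min one_pos hδ
    refine ⟨min 1 δ / (2 * (K + 1)), by positivity, fun t ht0 ht => ?_⟩
    rw [le_div_iff₀ (by positivity)] at ht
    have h2 : t * (K + 1) < min 1 δ := by nlinarith
    have h3 := h2.trans_le (min_le_left _ _)
    have h4 := h2.trans_le (min_le_right _ _)
    refine ⟨?_, ?_, ?_⟩ <;> nlinarith
  -- `F t x` has degree at most `finrank` in `t`, so `finrank + 1` nodes in `(0, ε]` determine `F 1
  -- x`. At each node the integral is the volume of the ball, hence also at `t = 1`, where the
  -- integrand vanishes.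
  obtain ⟨c, hc1, hc⟩ := exists_sum_eval_eq_eval_one (Nat.succ_pos (Module.finrank ℝ V))
    (fun i => ε / (i + 1)) (fun i j hij => by
      have hi : (0 : ℝ) < i + 1 := by positivity
      have hj : (0 : ℝ) < j + 1 := by positivity
      simp only at hij
      rw [div_eq_div_iff hi.ne' hj.ne', mul_right_inj' hε0.ne'] at hij
      exact_mod_cast (add_right_cancel hij).symm)
  have hF : ∀ x, F 1 x = ∑ i ∈ Finset.range (Module.finrank ℝ V).succ, c i * F (ε / (i + 1)) x := by
    intro x
    obtain ⟨p, hp, hpe⟩ := exists_polynomial_eval_eq_det_one_add_smul (fderiv ℝ g x)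
    simp only [F, hpe]
    exact hc p (Nat.lt_succ_of_le hp)
  have hF1 : ∀ x, F 1 x = 0 := by
    intro x
    have : (1 + (1 : ℝ) • fderiv ℝ g x : V →L[ℝ] V) = fderiv ℝ r x := by
      have : fderiv ℝ g x = fderiv ℝ r x - 1 :=
        ((hrd x).hasFDerivAt.sub (hasFDerivAt_id x)).fderiv
      rw [this]; simp
    simp only [F, this]
    exact det_fderiv_eq_zero_of_norm_eq_one (hrd x) h1
  have hint : ∫ x in ball (0 : V) 1, F 1 x = volume.real (ball (0 : V) 1) := by
    simp_rw [hF]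
    rw [integral_finsetSum _ fun i _ => (hFi _).const_mul _]
    simp_rw [integral_const_mul]
    have : ∀ i ∈ Finset.range (Module.finrank ℝ V).succ,
        c i * ∫ x in ball (0 : V) 1, F (ε / (i + 1)) x = c i * volume.real (ball (0 : V) 1) := by
      intro i _
      have hpos : 0 < ε / ((i : ℝ) + 1) := by positivity
      obtain ⟨h2, h3, h4⟩ := hε _ hpos (div_le_self hε0.le (by simp))
      rw [hvol _ hpos h2 h3 h4]
    rw [Finset.sum_congr rfl this, ← Finset.sum_mul, hc1, one_mul]
  simp only [hF1, integral_zero] at hint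
  have hpos : 0 < volume.real (ball (0 : V) 1) :=
    ENNReal.toReal_pos (measure_ball_pos volume _ one_pos).ne' measure_ball_lt_top.ne
  exact hpos.ne hint

end NoRetraction

/-! ### The sphere is not contractible in the punctured space. -/

section Nullhomotopy

open Metric Topology ContinuousMap

variable {V : Type*} [NormedAddCommGroup V] [InnerProductSpace ℝ V]

/-- Radial projection of the punctured space onto the unit sphere. -/
noncomputable def radialProjection (V : Type*) [NormedAddCommGroup V] [InnerProductSpace ℝ V] :
    C({v : V // v ≠ 0}, sphere (0 : V) 1) where
  toFun v := ⟨‖(v : V)‖⁻¹ • (v : V), by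
    rw [mem_sphere_zero_iff_norm, norm_smul, norm_inv, norm_norm,
      inv_mul_cancel₀ (norm_ne_zero_iff.2 v.2)]⟩
  continuous_toFun := by
    refine Continuous.subtype_mk (Continuous.smul (Continuous.inv₀ (by fun_prop) fun v => ?_)
      continuous_subtype_val) _
    exact norm_ne_zero_iff.2 v.2

/-- The inclusion of the unit sphere in the punctured space. -/
def sphereInclusion (V : Type*) [NormedAddCommGroup V] :
    C(sphere (0 : V) 1, {v : V // v ≠ 0}) where
  toFun x := ⟨x, ne_zero_of_mem_unit_sphere x⟩
  continuous_toFun := by fun_prop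

/-- The unit sphere of a finite-dimensional space is not contractible in the punctured space. -/
theorem not_nullhomotopic_sphereInclusion [FiniteDimensional ℝ V] :
    ¬ (sphereInclusion V).Nullhomotopic := by
  classical
  rintro ⟨y, ⟨H⟩⟩
  -- Running the nullhomotopy along the radius fills in the ball: `F` is constant for `‖v‖ < 1/4`
  -- and is radial projection for `‖v‖ ≥ 1/2`.
  let τ : V → unitInterval := fun v => Set.projIcc 0 1 zero_le_one (2 - 4 * ‖v‖)
  have hτ : Continuous τ := continuous_projIcc.comp (by fun_prop)
  let G : {v : V // v ≠ 0} → V := fun v => H (τ v, radialProjection V v)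
  have hG : Continuous G := by fun_prop
  let F : V → V := fun v => if h : v = 0 then y else G ⟨v, h⟩
  have hFG : ∀ v : {v : V // v ≠ 0}, F v = G v := fun v => dif_neg v.2
  have hFy : ∀ v, ‖v‖ < 1 / 4 → F v = y := by
    intro v hv
    by_cases h : v = 0
    · exact dif_pos h
    · have : τ v = 1 := Set.projIcc_of_right_le _ (by linarith)
      simp [F, h, G, this]
  have hF1 : ∀ v, 1 / 2 ≤ ‖v‖ → F v = ‖v‖⁻¹ • v := by
    intro v hv
    have h : v ≠ 0 := by rintro rfl; norm_num at hv
    have : τ v = 0 := Set.projIcc_of_le_left _ (by linarith)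
    rw [hFG ⟨v, h⟩]
    simp only [G, this, H.apply_zero]
    rfl
  have hF0 : ∀ v, F v ≠ 0 := by
    intro v
    by_cases h : v = 0
    · simpa [F, h] using y.2
    · simpa [F, h, G] using (H (τ v, radialProjection V ⟨v, h⟩)).2
  have hF : Continuous F := by
    refine continuous_iff_continuousAt.2 fun v => ?_
    by_cases h : v = 0
    · refine (continuousAt_const (y := (y : V))).congr ?_
      filter_upwards [ball_mem_nhds v (show (0 : ℝ) < 1 / 4 by norm_num)] with w hw
      rw [h, mem_ball_zero_iff] at hw
      exact (hFy w hw).symm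
    · have hemb : IsOpenEmbedding ((↑) : {v : V // v ≠ 0} → V) :=
        isOpen_ne.isOpenEmbedding_subtypeVal
      refine (hemb.continuousAt_iff (x := ⟨v, h⟩)).1 ?_
      have : F ∘ ((↑) : {v : V // v ≠ 0} → V) = G := funext hFG
      rw [this]
      exact hG.continuousAt
  -- An error below `‖F v‖` keeps `g` nonzero. `F` is already smooth on `‖v‖ > 1/2`, so it can be
  -- left unchanged on `‖v‖ ≥ 1`.
  obtain ⟨g, hg, hgF, hgS, -⟩ := hF.exists_contDiff_approx_and_eqOn 1 hF.norm
    (fun v => norm_pos_iff.2 (hF0 v)) (S := {v | 1 ≤ ‖v‖}) (U := {v | 1 / 2 < ‖v‖})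
    (isClosed_le continuous_const continuous_norm)
    ((isOpen_lt continuous_const continuous_norm).mem_nhdsSet.2 fun v (hv : 1 ≤ ‖v‖) =>
      show 1 / 2 < ‖v‖ by linarith)
    (by
      have : ContDiffOn ℝ 1 (fun v : V => ‖v‖⁻¹ • v) {v | 1 / 2 < ‖v‖} := by
        intro v (hv : 1 / 2 < ‖v‖)
        have h : v ≠ 0 := by rintro rfl; norm_num at hv
        exact (((contDiffAt_norm ℝ h).inv (norm_ne_zero_iff.2 h)).smul
          contDiffAt_id).contDiffWithinAt
      exact this.congr fun v (hv : 1 / 2 < ‖v‖) => hF1 v hv.le)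
  have hg0 : ∀ v, g v ≠ 0 := by
    intro v h
    have := hgF v
    rw [h, dist_zero_left] at this
    exact lt_irrefl _ this
  refine not_exists_contDiff_retraction (r := fun v => ‖g v‖⁻¹ • g v)
    (((hg.norm ℝ hg0).inv fun v => norm_ne_zero_iff.2 (hg0 v)).smul hg) (fun x hx => ?_)
    fun v => ?_
  · rw [mem_sphere_zero_iff_norm] at hx
    have : g x = x := by
      rw [hgS (show 1 ≤ ‖x‖ from hx.ge), hF1 x (by rw [hx]; norm_num), hx]; simp
    simp [this, hx]
  · rw [norm_smul, norm_inv, norm_norm, inv_mul_cancel₀ (norm_ne_zero_iff.2 (hg0 v))]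

/-- A map to the punctured space given by a nowhere vanishing continuous function. -/
def toPunctured {X : Type*} [TopologicalSpace X] {u : X → V} (hu : Continuous u)
    (hu0 : ∀ x, u x ≠ 0) : C(X, {v : V // v ≠ 0}) :=
  ⟨fun x => ⟨u x, hu0 x⟩, hu.subtype_mk _⟩

/-- Two nowhere vanishing maps that never point in opposite directions are homotopic as maps to
the punctured space. -/
theorem toPunctured_homotopic {X : Type*} [TopologicalSpace X] {u v : X → V} (hu : Continuous u)
    (hu0 : ∀ x, u x ≠ 0) (hv : Continuous v) (hv0 : ∀ x, v x ≠ 0)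
    (h : ∀ x (t : ℝ), 0 < t → t < 1 → (1 - t) • u x + t • v x ≠ 0) :
    (toPunctured hu hu0).Homotopic (toPunctured hv hv0) := by
  refine ⟨⟨⟨fun p => ⟨(1 - (p.1 : ℝ)) • u p.2 + (p.1 : ℝ) • v p.2, ?_⟩, ?_⟩, ?_, ?_⟩⟩
  · obtain ⟨⟨t, ht0, ht1⟩, x⟩ := p
    rcases ht0.eq_or_lt with rfl | ht0
    · simpa using hu0 x
    rcases ht1.eq_or_lt with rfl | ht1
    · simpa using hv0 x
    exact h x t ht0 ht1
  · exact Continuous.subtype_mk (by fun_prop) _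
  · intro x; simp [toPunctured]
  · intro x; simp [toPunctured]

end Nullhomotopy

/-! ### Nowhere vanishing sections of line bundles over spheres. -/

section Lift

open Metric Topology ContinuousMap

variable {V : Type*} [NormedAddCommGroup V] [InnerProductSpace ℝ V]

/-- Any vector of a line is a multiple of any nonzero vector of that line. -/
theorem Projectivization.exists_smul_eq_of_mem_submodule {ℓ : ℙ ℝ V} {u v : V}
    (hu : u ∈ ℓ.submodule) (hu0 : u ≠ 0) (hv : v ∈ ℓ.submodule) : ∃ a : ℝ, a • u = v := by
  obtain ⟨a, ha⟩ := (finrank_eq_one_iff_of_nonzero' (⟨u, hu⟩ : ℓ.submodule)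
    (by simpa using hu0)).1 ℓ.finrank_submodule ⟨v, hv⟩
  exact ⟨a, congrArg Subtype.val ha⟩

theorem Projectivization.inner_ne_zero_of_mem_submodule {ℓ : ℙ ℝ V} {u v : V}
    (hu : u ∈ ℓ.submodule) (hu0 : u ≠ 0) (hv : v ∈ ℓ.submodule) (hv0 : v ≠ 0) :
    inner ℝ u v ≠ 0 := by
  obtain ⟨a, rfl⟩ := exists_smul_eq_of_mem_submodule hu hu0 hv
  rw [inner_smul_right]
  exact mul_ne_zero (left_ne_zero_of_smul hv0) (inner_self_ne_zero.2 hu0)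

/-- Positively related vectors of a line have the same normalization. -/
theorem Projectivization.normalize_eq_of_mem_submodule {ℓ : ℙ ℝ V} {u v : V}
    (hu : u ∈ ℓ.submodule) (hu0 : u ≠ 0) (hv : v ∈ ℓ.submodule) (h : 0 < inner ℝ u v) :
    ‖u‖⁻¹ • u = ‖v‖⁻¹ • v := by
  obtain ⟨a, rfl⟩ := exists_smul_eq_of_mem_submodule hu hu0 hv
  rw [inner_smul_right, real_inner_self_eq_norm_sq] at h
  have ha : 0 < a := pos_of_mul_pos_left h (sq_nonneg _)
  rw [norm_smul, Real.norm_of_nonneg ha.le, smul_smul, mul_inv, mul_right_comm,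
    inv_mul_cancel₀ ha.ne', one_mul]

/-- The orthogonal projection onto a line. -/
noncomputable def lineProjection (ℓ : ℙ ℝ V) : V →L[ℝ] V := ℓ.submodule.starProjection

theorem lineProjection_mem (ℓ : ℙ ℝ V) (v : V) : lineProjection ℓ v ∈ ℓ.submodule :=
  ℓ.submodule.starProjection_apply_mem v

theorem lineProjection_eq_self {ℓ : ℙ ℝ V} {v : V} (hv : v ∈ ℓ.submodule) :
    lineProjection ℓ v = v :=
  Submodule.starProjection_eq_self_iff.2 hv

/-- If the second projection killed `v`, the difference of the projections would preserve `‖v‖`.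
This allows a section to be projected onto a nearby bundle. -/
theorem lineProjection_ne_zero_of_dist_lt {ℓ ℓ' : ℙ ℝ V} {v : V} (hv : v ∈ ℓ.submodule)
    (hv0 : v ≠ 0) (h : dist (lineProjection ℓ) (lineProjection ℓ') < 1) :
    lineProjection ℓ' v ≠ 0 := by
  intro h0
  have h1 := (lineProjection ℓ - lineProjection ℓ').le_opNorm v
  rw [_root_.sub_apply, lineProjection_eq_self hv, h0, sub_zero, ← dist_eq_norm] at h1
  nlinarith [norm_pos_iff.2 hv0]

variable [FiniteDimensional ℝ V]

theorem continuous_lineProjection : Continuous (lineProjection : ℙ ℝ V → V →L[ℝ] V) := by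
  refine continuous_coinduced_dom.2 (continuous_clm_apply.2 fun w => ?_)
  have : ∀ v : {v : V // v ≠ 0}, lineProjection (Projectivization.mk' ℝ v) w =
      (inner ℝ (v : V) w / ‖(v : V)‖ ^ 2) • (v : V) := by
    intro v
    rw [lineProjection, Projectivization.mk'_eq_mk]
    simp only [Projectivization.submodule_mk]
    exact Submodule.starProjection_singleton ℝ w
  simp only [Function.comp_apply, this]
  refine Continuous.smul (Continuous.div (by fun_prop) (by fun_prop) fun v => ?_)
    continuous_subtype_val
  exact pow_ne_zero _ (norm_ne_zero_iff.2 v.2)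

/-- Nowhere vanishing sections of a line bundle can be transported along homotopies of the
classifying map. -/
theorem exists_section_of_homotopy {X : Type*} [PseudoMetricSpace X] [CompactSpace X]
    {Φ : unitInterval × X → ℙ ℝ V} (hΦ : Continuous Φ) {f₀ : X → V} (hf₀ : Continuous f₀)
    (hf₀0 : ∀ x, f₀ x ≠ 0) (hf₀Φ : ∀ x, f₀ x ∈ (Φ (0, x)).submodule) :
    ∃ f : X → V, Continuous f ∧ ∀ x, f x ≠ 0 ∧ f x ∈ (Φ (1, x)).submodule := by
  have hP : Continuous fun p => lineProjection (Φ p) := continuous_lineProjection.comp hΦ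
  -- Compactness gives a uniform step length for which consecutive projections differ by less than
  -- `1`; the section is then projected from step to step.
  obtain ⟨δ, hδ, hPδ⟩ := Metric.uniformContinuous_iff.1
    (CompactSpace.uniformContinuous_of_continuous hP) 1 one_pos
  obtain ⟨N, hN⟩ := exists_nat_one_div_lt hδ
  let τ : ℕ → unitInterval := fun k => Set.projIcc 0 1 zero_le_one ((k : ℝ) / (N + 1))
  have hτ : ∀ k, dist (τ k) (τ (k + 1)) < δ := by
    intro k
    refine lt_of_le_of_lt ?_ hN
    refine ((LipschitzWith.projIcc (zero_le_one' ℝ)).dist_le_mul _ _).trans ?_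
    rw [NNReal.coe_one, one_mul, Real.dist_eq, ← sub_div, abs_div, abs_of_pos (by positivity :
      (0 : ℝ) < N + 1)]
    simp
  have key : ∀ k, ∃ f : X → V, Continuous f ∧ ∀ x, f x ≠ 0 ∧ f x ∈ (Φ (τ k, x)).submodule := by
    intro k
    induction k with
    | zero =>
      have : τ 0 = 0 := Set.projIcc_of_le_left _ (by simp)
      exact ⟨f₀, hf₀, fun x => ⟨hf₀0 x, by rw [this]; exact hf₀Φ x⟩⟩
    | succ k ih =>
      obtain ⟨f, hf, hfx⟩ := ih
      refine ⟨fun x => lineProjection (Φ (τ (k + 1), x)) (f x),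
        (hP.comp (by fun_prop : Continuous fun x => (τ (k + 1), x))).clm_apply hf,
        fun x => ⟨lineProjection_ne_zero_of_dist_lt (hfx x).2 (hfx x).1 (hPδ ?_),
          lineProjection_mem _ _⟩⟩
      rw [Prod.dist_eq, dist_self]
      exact max_lt (hτ k) hδ
  have h1 : τ (N + 1) = 1 := by
    refine Set.projIcc_of_right_le _ ?_
    rw [Nat.cast_add, Nat.cast_one, div_self (by positivity)]
  simpa only [h1] using key (N + 1)

/-- A line bundle over the sphere has a nowhere vanishing section over any closed hemisphere. -/
theorem exists_section_hemisphere {φ : sphere (0 : V) 1 → ℙ ℝ V} (hφ : Continuous φ)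
    (e : sphere (0 : V) 1) :
    ∃ f : sphere (0 : V) 1 → V, Continuous f ∧ ∀ x, f x ≠ 0 ∧
      (0 ≤ inner ℝ (x : V) (e : V) → f x ∈ (φ x).submodule) := by
  have he : inner ℝ (e : V) (e : V) = 1 := by
    rw [real_inner_self_eq_norm_sq, norm_eq_of_mem_sphere]; norm_num
  -- `σ` folds the sphere onto the hemisphere around `e`. The segment from `e` to `σ x` avoids `0`,
  -- so its normalization contracts that hemisphere to `e`, where the bundle has a constant section.
  let σ : sphere (0 : V) 1 → V := fun x =>
    (x : V) + (|inner ℝ (x : V) (e : V)| - inner ℝ (x : V) (e : V)) • (e : V)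
  let u : unitInterval × sphere (0 : V) 1 → V := fun p =>
    (1 - (p.1 : ℝ)) • (e : V) + (p.1 : ℝ) • σ p.2
  have hu : Continuous u := by fun_prop
  have hu0 : ∀ p, u p ≠ 0 := by
    rintro ⟨⟨t, ht0, ht1⟩, x⟩ h
    have h1 : (1 - t) + t * |inner ℝ (x : V) (e : V)| = 0 := by
      have := congrArg (fun v => inner ℝ v (e : V)) h
      simp [u, σ, inner_add_left, inner_smul_left] at this
      linarith
    have h2 := abs_nonneg (inner ℝ (x : V) (e : V))
    have h3 : t = 1 := by nlinarith
    subst h3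
    have h4 : inner ℝ (x : V) (e : V) = 0 := by simpa using h1
    exact ne_zero_of_mem_unit_sphere x (by simpa [u, σ, h4] using h)
  let H : C(unitInterval × sphere (0 : V) 1, sphere (0 : V) 1) :=
    (radialProjection V).comp (toPunctured hu hu0)
  have hH0 : ∀ x, H (0, x) = e := by
    intro x
    ext1
    simp [H, radialProjection, toPunctured, u]
  obtain ⟨f, hf, hfx⟩ := exists_section_of_homotopy (Φ := fun p => φ (H p))
    (hφ.comp H.continuous) (f₀ := fun _ => (φ e).rep) continuous_const
    (fun _ => (φ e).rep_nonzero) (fun x => by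
      rw [hH0, Projectivization.submodule_eq]
      exact Submodule.mem_span_singleton_self _)
  refine ⟨f, hf, fun x => ⟨(hfx x).1, fun hx => ?_⟩⟩
  have hH1 : H (1, x) = x := by
    ext1
    simp [H, radialProjection, toPunctured, u, σ, abs_of_nonneg hx]
  simpa only [hH1] using (hfx x).2

/-- Line bundles over spheres of dimension at least two are trivial. -/
theorem exists_section_sphere (hV : 2 < Module.finrank ℝ V) {φ : sphere (0 : V) 1 → ℙ ℝ V}
    (hφ : Continuous φ) :
    ∃ f : sphere (0 : V) 1 → V, Continuous f ∧ ∀ x, f x ≠ 0 ∧ f x ∈ (φ x).submodule := by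
  have : Nontrivial V := Module.nontrivial_of_finrank_pos (R := ℝ) (by omega)
  obtain ⟨e, he⟩ : (sphere (0 : V) 1).Nonempty := NormedSpace.sphere_nonempty.2 zero_le_one
  obtain ⟨f, hf, hfx⟩ := exists_section_hemisphere hφ ⟨e, he⟩
  obtain ⟨g, hg, hgx⟩ := exists_section_hemisphere hφ ⟨-e, by simpa using he⟩
  simp only [inner_neg_right, Left.nonneg_neg_iff] at hfx hgx
  let E := (Submodule.span ℝ {e})ᗮ
  have hE : 1 < Module.rank ℝ E := by
    have : Module.finrank ℝ (Submodule.span ℝ {e}) = 1 :=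
      finrank_span_singleton (ne_zero_of_mem_unit_sphere ⟨e, he⟩)
    have h2 : Module.finrank ℝ (Submodule.span ℝ {e}) + Module.finrank ℝ E = _ :=
      (Submodule.span ℝ {e}).finrank_add_finrank_orthogonal
    rw [← Module.finrank_eq_rank]
    exact_mod_cast (by omega : 1 < Module.finrank ℝ E)
  have : PreconnectedSpace (sphere (0 : E) 1) :=
    isPreconnected_iff_preconnectedSpace.1 (isPreconnected_sphere hE 0 1)
  let ι : sphere (0 : E) 1 → sphere (0 : V) 1 := fun x => ⟨(x : E),
    mem_sphere_zero_iff_norm.2 (mem_sphere_zero_iff_norm.1 x.2 : ‖(x : E)‖ = 1)⟩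
  have hι : Continuous ι := by fun_prop
  have hιe : ∀ x, inner ℝ (ι x : V) e = 0 := fun x =>
    Submodule.mem_orthogonal_singleton_iff_inner_left.1 (x : E).2
  have hs0 : ∀ x, inner ℝ (f (ι x)) (g (ι x)) ≠ 0 := fun x =>
    Projectivization.inner_ne_zero_of_mem_submodule ((hfx _).2 (hιe x).ge) (hfx _).1
      ((hgx _).2 (hιe x).le) (hgx _).1
  have hs : Continuous fun x => inner ℝ (f (ι x)) (g (ι x)) := by fun_prop
  -- The equator is connected, so the relative sign of the two sections is constant on it. After
  -- correcting that sign the normalized sections agree there and glue.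
  obtain ⟨s, hs1, hspos⟩ : ∃ s : ℝ, s ≠ 0 ∧ ∀ x, 0 < inner ℝ (f (ι x)) (s • g (ι x)) := by
    by_cases h : ∀ x, 0 < inner ℝ (f (ι x)) (g (ι x))
    · exact ⟨1, one_ne_zero, by simpa using h⟩
    · push Not at h
      obtain ⟨x, hx⟩ := h
      refine ⟨-1, by norm_num, fun y => ?_⟩
      by_contra hy
      simp only [neg_smul, one_smul, inner_neg_right, Left.neg_pos_iff, not_lt] at hy
      obtain ⟨z, hz⟩ := mem_range_of_exists_le_of_exists_ge hs ⟨x, hx⟩ ⟨y, hy⟩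
      exact hs0 z hz
  have hf1 : Continuous fun x => ‖f x‖⁻¹ • f x :=
    (hf.norm.inv₀ fun x => norm_ne_zero_iff.2 (hfx x).1).smul hf
  have hg0 : ∀ x, s • g x ≠ 0 := fun x => smul_ne_zero hs1 (hgx x).1
  have hg1 : Continuous fun x => ‖s • g x‖⁻¹ • s • g x :=
    ((hg.const_smul s).norm.inv₀ fun x => norm_ne_zero_iff.2 (hg0 x)).smul (hg.const_smul s)
  refine ⟨fun x => if 0 ≤ inner ℝ (x : V) e then ‖f x‖⁻¹ • f x else ‖s • g x‖⁻¹ • s • g x,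
    hf1.if_le hg1 continuous_const (by fun_prop) fun x hx => ?_, fun x => ?_⟩
  · have hxE : (x : V) ∈ E := Submodule.mem_orthogonal_singleton_iff_inner_left.2 hx.symm
    have h1 := hspos ⟨⟨x, hxE⟩, by simp⟩
    exact Projectivization.normalize_eq_of_mem_submodule ((hfx x).2 hx.le) (hfx x).1
      (Submodule.smul_mem _ s ((hgx x).2 hx.ge)) h1
  · dsimp only
    split_ifs with h
    · exact ⟨smul_ne_zero (inv_ne_zero (norm_ne_zero_iff.2 (hfx x).1)) (hfx x).1,
        Submodule.smul_mem _ _ ((hfx x).2 h)⟩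
    · exact ⟨smul_ne_zero (inv_ne_zero (norm_ne_zero_iff.2 (hg0 x))) (hg0 x),
        Submodule.smul_mem _ _ (Submodule.smul_mem _ s ((hgx x).2 (not_le.1 h).le))⟩

/-- In the plane, a line bundle avoiding a nowhere vanishing vector field is trivial. -/
theorem exists_section_of_finrank_eq_two (hV : Module.finrank ℝ V = 2) {X : Type*}
    [TopologicalSpace X] {φ : X → ℙ ℝ V} (hφ : Continuous φ) {w : X → V} (hw : Continuous w)
    (hwφ : ∀ x, w x ∉ (φ x).submodule) :
    ∃ f : X → V, Continuous f ∧ ∀ x, f x ≠ 0 ∧ f x ∈ (φ x).submodule := by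
  have : Fact (Module.finrank ℝ V = 1 + 1) := ⟨hV⟩
  have : Fact (Module.finrank ℝ V = 2) := ⟨hV⟩
  -- If the projection of `J w` onto the line vanished, the line would be orthogonal to `J w`, hence
  -- spanned by `w`.
  let J := (Module.finBasisOfFinrankEq ℝ V hV).orientation.rightAngleRotation
  refine ⟨fun x => lineProjection (φ x) (J (w x)),
    (continuous_lineProjection.comp hφ).clm_apply (J.continuous.comp hw),
    fun x => ⟨fun h => hwφ x ?_, lineProjection_mem _ _⟩⟩
  have hw0 : w x ≠ 0 := fun h0 => hwφ x (h0 ▸ Submodule.zero_mem _)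
  have hJ0 : J (w x) ≠ 0 := by simpa using hw0
  let u := (φ x).rep
  have hu : u ∈ (φ x).submodule := by
    rw [Projectivization.submodule_eq]; exact Submodule.mem_span_singleton_self _
  have h1 : u ∈ (Submodule.span ℝ {J (w x)})ᗮ := by
    refine Submodule.mem_orthogonal_singleton_iff_inner_left.2 ?_
    have := (φ x).submodule.starProjection_apply_eq_zero_iff.1 h
    exact (Submodule.mem_orthogonal _ _).1 this u hu
  have h2 : w x ∈ (Submodule.span ℝ {J (w x)})ᗮ :=
    Submodule.mem_orthogonal_singleton_iff_inner_left.2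
      (by rw [real_inner_comm]; exact Orientation.inner_rightAngleRotation_self _ _)
  obtain ⟨a, ha⟩ := (finrank_eq_one_iff_of_nonzero'
    (⟨u, h1⟩ : (Submodule.span ℝ {J (w x)})ᗮ) (by simpa using (φ x).rep_nonzero)).1
    (Submodule.finrank_orthogonal_span_singleton hJ0) ⟨w x, h2⟩
  have ha' : a • u = w x := congrArg Subtype.val ha
  rw [← ha']
  exact Submodule.smul_mem _ _ hu

/-- A line bundle over the unit sphere which avoids a vector field has a nowhere vanishing
section. -/
theorem exists_section_of_avoids {φ : sphere (0 : V) 1 → ℙ ℝ V} (hφ : Continuous φ)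
    {w : sphere (0 : V) 1 → V} (hw : Continuous w) (hwφ : ∀ x, w x ∉ (φ x).submodule) :
    ∃ f : sphere (0 : V) 1 → V, Continuous f ∧ ∀ x, f x ≠ 0 ∧ f x ∈ (φ x).submodule := by
  rcases lt_trichotomy (Module.finrank ℝ V) 2 with h | h | h
  -- Below dimension two a line is the whole space, so nothing avoids it.
  · have : ∀ x, False := fun x => by
      refine hwφ x ?_
      have h1 := (φ x).submodule.finrank_le
      rw [Projectivization.finrank_submodule] at h1
      rw [Submodule.eq_top_of_finrank_eq (S := (φ x).submodule)
        (by rw [Projectivization.finrank_submodule]; omega)]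
      trivial
    exact ⟨fun x => x, continuous_subtype_val, fun x => (this x).elim⟩
  · exact exists_section_of_finrank_eq_two h hφ hw hwφ
  · exact exists_section_sphere h hφ

end Lift

/-! ### The homotopy argument for missed points. -/

section Interior

open Metric Topology ContinuousMap

variable {V : Type*} [NormedAddCommGroup V] [InnerProductSpace ℝ V] [FiniteDimensional ℝ V]

omit [FiniteDimensional ℝ V] in
-- A zero on the segment from `w x` to `f x` would put `w x` on the line of `f x`.
theorem toPunctured_homotopic_section {X : Type*} [TopologicalSpace X] {φ : X → ℙ ℝ V}
    {w f : X → V} (hw : Continuous w) (hw0 : ∀ x, w x ≠ 0) (hwφ : ∀ x, w x ∉ (φ x).submodule)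
    (hf : Continuous f) (hf0 : ∀ x, f x ≠ 0) (hfφ : ∀ x, f x ∈ (φ x).submodule) :
    (toPunctured hw hw0).Homotopic (toPunctured hf hf0) := by
  refine toPunctured_homotopic hw hw0 hf hf0 fun x t _ ht1 h => hwφ x ?_
  have h1 : (1 - t) • w x ∈ (φ x).submodule := by
    rw [eq_neg_of_add_eq_zero_left h]
    exact Submodule.neg_mem _ (Submodule.smul_mem _ _ (hfφ x))
  exact (Submodule.smul_mem_iff _ (sub_pos.2 ht1).ne').1 h1

omit [FiniteDimensional ℝ V] in
-- Shrinking `u` to `0` never makes it meet `v`, which is longer.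
theorem nullhomotopic_toPunctured_of_norm_lt {X : Type*} [TopologicalSpace X] {u : X → V}
    (hu : Continuous u) {v : V} (huv : ∀ x, ‖u x‖ < ‖v‖) (h0 : ∀ x, u x - v ≠ 0)
    (hv : v ≠ 0) :
    (toPunctured (hu.sub continuous_const) h0).Nullhomotopic := by
  refine ⟨⟨-v, neg_ne_zero.2 hv⟩, toPunctured_homotopic (hu.sub continuous_const) h0
    continuous_const (fun _ => neg_ne_zero.2 hv) fun x t ht0 ht1 h => ?_⟩
  change (1 - t) • (u x - v) + t • -v = 0 at h
  have h1 : (1 - t) • u x = v := by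
    rw [← sub_eq_zero, ← h, smul_sub, sub_smul 1 t v, one_smul, smul_neg]; abel
  have h2 := huv x
  rw [← h1, norm_smul, Real.norm_of_nonneg (sub_pos.2 ht1).le] at h2
  nlinarith [norm_nonneg (u x)]

/-- The affine lines attached by a continuous map to the points of a starlike hypersurface sweep
out a set with nonempty interior. -/
theorem nonempty_interior_sweep_starlike [Nontrivial V] {φ : sphere (0 : V) 1 → ℙ ℝ V}
    (hφ : Continuous φ) {ρ : sphere (0 : V) 1 → ℝ} (hρ : Continuous ρ) (hρ0 : ∀ x, 0 < ρ x)
    (c : V) :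
    (interior {y | ∃ x : sphere (0 : V) 1, y - (c + ρ x • (x : V)) ∈ (φ x).submodule}).Nonempty := by
  by_contra hne
  rw [Set.not_nonempty_iff_eq_empty, interior_eq_empty_iff_dense_compl] at hne
  have : Nonempty (sphere (0 : V) 1) :=
    (NormedSpace.sphere_nonempty.2 zero_le_one).to_subtype
  obtain ⟨a, ha⟩ : ∃ a, ∀ x, ρ a ≤ ρ x := by
    obtain ⟨a, -, ha⟩ := isCompact_univ.exists_isMinOn Set.univ_nonempty hρ.continuousOn
    exact ⟨a, fun x => ha (Set.mem_univ x)⟩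
  obtain ⟨b, hb⟩ : ∃ b, ∀ x, ρ x ≤ ρ b := by
    obtain ⟨b, -, hb⟩ := isCompact_univ.exists_isMaxOn Set.univ_nonempty hρ.continuousOn
    exact ⟨b, fun x => hb (Set.mem_univ x)⟩
  obtain ⟨y, hy, hyφ⟩ := hne.exists_mem_open (isOpen_ball (x := c) (ε := ρ a))
    ⟨c, mem_ball_self (hρ0 a)⟩ |>.imp fun _ h => And.symm h
  obtain ⟨z, hz, hzφ⟩ := hne.exists_mem_open (isOpen_lt continuous_const
    (continuous_id.sub continuous_const).norm : IsOpen {z | ρ b < ‖z - c‖}) (by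
      obtain ⟨v, hv⟩ := NormedSpace.exists_lt_norm ℝ V (ρ b)
      exact ⟨v + c, by simpa using hv⟩) |>.imp fun _ h => And.symm h
  have hnot : ∀ y : V, (y ∈ {y | ∃ x : sphere (0 : V) 1,
      y - (c + ρ x • (x : V)) ∈ (φ x).submodule}ᶜ) →
      ∀ x : sphere (0 : V) 1, ρ x • (x : V) - (y - c) ∉ (φ x).submodule := by
    intro y hy x hx
    refine hy ⟨x, ?_⟩
    rw [← neg_mem_iff]
    convert hx using 1
    abel
  have hwy := hnot y hyφ
  have hwz := hnot z hzφ
  have h0 : ∀ {w : sphere (0 : V) 1 → V}, (∀ x, w x ∉ (φ x).submodule) → ∀ x, w x ≠ 0 :=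
    fun h x hx => h x (hx ▸ Submodule.zero_mem _)
  have hu : Continuous fun x : sphere (0 : V) 1 => ρ x • (x : V) := by fun_prop
  have hnorm : ∀ x : sphere (0 : V) 1, ‖ρ x • (x : V)‖ = ρ x := fun x => by
    rw [norm_smul, norm_eq_of_mem_sphere, mul_one, Real.norm_of_nonneg (hρ0 x).le]
  obtain ⟨f, hf, hfx⟩ := exists_section_of_avoids hφ (hu.sub continuous_const) hwy
  have h1 := toPunctured_homotopic_section (hu.sub continuous_const) (h0 hwy) hwy hf
    (fun x => (hfx x).1) fun x => (hfx x).2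
  have h2 := toPunctured_homotopic_section (hu.sub continuous_const) (h0 hwz) hwz hf
    (fun x => (hfx x).1) fun x => (hfx x).2
  -- Since `‖y - c‖ < ρ x`, both fields have positive inner product with `x`, and so does the
  -- segment between them.
  have h3 : (sphereInclusion V).Homotopic (toPunctured (hu.sub continuous_const) (h0 hwy)) := by
    refine toPunctured_homotopic continuous_subtype_val (fun x => ne_zero_of_mem_unit_sphere x)
      (hu.sub continuous_const) (h0 hwy) fun x t ht0 ht1 h => ?_
    have hxx : inner ℝ (x : V) (x : V) = 1 := by
      rw [real_inner_self_eq_norm_sq, norm_eq_of_mem_sphere]; norm_num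
    change (1 - t) • (x : V) + t • (ρ x • (x : V) - (y - c)) = 0 at h
    have h4 := congrArg (fun v => inner ℝ v (x : V)) h
    simp only [inner_add_left, inner_smul_left, inner_sub_left (ρ x • (x : V)), hxx,
      inner_zero_left] at h4
    have h5 : inner ℝ (y - c) (x : V) ≤ ‖y - c‖ := by
      simpa using real_inner_le_norm (y - c) (x : V)
    rw [mem_ball, dist_eq_norm] at hy
    have h6 : 0 < ρ x - inner ℝ (y - c) (x : V) := by linarith [ha x]
    simp only [conj_trivial, mul_one] at h4
    nlinarith [mul_pos ht0 h6]
  have hz0 : ρ b < ‖z - c‖ := hz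
  obtain ⟨v, hv⟩ := nullhomotopic_toPunctured_of_norm_lt hu (v := z - c)
    (fun x => (hnorm x).trans_lt ((hb x).trans_lt hz0)) (h0 hwz)
    (norm_pos_iff.1 ((hρ0 b).trans hz0))
  exact not_nullhomotopic_sphereInclusion ⟨v, h3.trans (h1.trans (h2.symm.trans hv))⟩

/-- The lines of a tangent line bundle over a sphere pass through every exterior point. -/
theorem exists_sub_mem_of_tangent {φ : sphere (0 : V) 1 → ℙ ℝ V} (hφ : Continuous φ)
    (hφt : ∀ x, (φ x).submodule ≤ (Submodule.span ℝ {(x : V)})ᗮ) {R : ℝ} (hR : 0 < R) {z : V}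
    (hz : R < ‖z‖) : ∃ x : sphere (0 : V) 1, z - R • (x : V) ∈ (φ x).submodule := by
  by_contra! hzφ
  have hxx : ∀ x : sphere (0 : V) 1, inner ℝ (x : V) (x : V) = 1 := fun x => by
    rw [real_inner_self_eq_norm_sq, norm_eq_of_mem_sphere]; norm_num
  -- Tangency makes the centre a missed point, so it takes the role of `y`.
  have hxφ : ∀ x : sphere (0 : V) 1, (x : V) ∉ (φ x).submodule := fun x hx => by
    have := Submodule.mem_orthogonal_singleton_iff_inner_left.1 (hφt x hx)
    rw [hxx] at this
    exact one_ne_zero this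
  have hwφ : ∀ x : sphere (0 : V) 1, R • (x : V) - z ∉ (φ x).submodule := fun x hx =>
    hzφ x (by rw [← neg_mem_iff, neg_sub]; exact hx)
  have hw0 : ∀ x : sphere (0 : V) 1, R • (x : V) - z ≠ 0 := fun x hx =>
    hwφ x (by rw [hx]; exact Submodule.zero_mem _)
  have hu : Continuous fun x : sphere (0 : V) 1 => R • (x : V) := by fun_prop
  obtain ⟨f, hf, hfx⟩ := exists_section_of_avoids hφ continuous_subtype_val hxφ
  have h1 := toPunctured_homotopic_section continuous_subtype_val
    (fun x => ne_zero_of_mem_unit_sphere x) hxφ hf (fun x => (hfx x).1) fun x => (hfx x).2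
  have h2 := toPunctured_homotopic_section (hu.sub continuous_const) hw0 hwφ hf
    (fun x => (hfx x).1) fun x => (hfx x).2
  obtain ⟨v, hv⟩ := nullhomotopic_toPunctured_of_norm_lt hu (v := z)
    (fun x => by rwa [norm_smul, norm_eq_of_mem_sphere, mul_one, Real.norm_of_nonneg hR.le]) hw0
    (norm_pos_iff.1 (hR.trans hz))
  exact not_nullhomotopic_sphereInclusion ⟨v, h1.trans (h2.symm.trans hv)⟩

end Interior

/-! ### Transfer to embedded line bundles, spheres and ellipsoids. -/

section Sweep

open Metric

theorem EmbeddedLineBundle.mem_codiagonal_image {V : Type*} [AddCommGroup V] [Module ℝ V]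
    [TopologicalSpace V] {X : Set V} (L : EmbeddedLineBundle X) {y : V} :
    y ∈ codiagonal '' L.totalSpace ↔ ∃ x : X, y - x ∈ (L.toFun x).submodule := by
  constructor
  · rintro ⟨⟨_, u⟩, ⟨x, rfl, hu⟩, rfl⟩
    exact ⟨x, by simpa [codiagonal] using hu⟩
  · rintro ⟨x, hx⟩
    exact ⟨(x, y - x), ⟨x, rfl, hx⟩, by simp [codiagonal]⟩

theorem EmbeddedLineBundle.nonempty_interior_of_starlike {V : Type*} [NormedAddCommGroup V]
    [InnerProductSpace ℝ V] [FiniteDimensional ℝ V] [Nontrivial V] {X : Set V}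
    (L : EmbeddedLineBundle X) {ρ : sphere (0 : V) 1 → ℝ} (hρ : Continuous ρ)
    (hρ0 : ∀ x, 0 < ρ x) (c : V) (hX : ∀ x : sphere (0 : V) 1, c + ρ x • (x : V) ∈ X) :
    (interior (codiagonal '' L.totalSpace)).Nonempty := by
  have hφ : Continuous fun x : sphere (0 : V) 1 => L.toFun ⟨c + ρ x • (x : V), hX x⟩ :=
    L.continuous_toFun.comp (by fun_prop)
  refine (nonempty_interior_sweep_starlike hφ hρ hρ0 c).mono (interior_mono ?_)
  rintro y ⟨x, hx⟩
  exact L.mem_codiagonal_image.2 ⟨_, hx⟩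

/-- By Pythagoras, `‖y - c‖² = R² + ‖y - x‖²` on a tangent line at `x`, so the open ball is missed.
Sphere points lie on their own lines; exterior points are reached by `exists_sub_mem_of_tangent`. -/
theorem EmbeddedLineBundle.codiagonal_image_of_tangent {n : ℕ}
    {c : EuclideanSpace ℝ (Fin (n + 1))} {R : ℝ} (hR : 0 < R)
    (L : EmbeddedLineBundle (sphere c R)) (hL : L.IsTangentToSphere) :
    codiagonal '' L.totalSpace = (ball c R)ᶜ := by
  ext y
  rw [L.mem_codiagonal_image, Set.mem_compl_iff, mem_ball, not_lt]
  constructor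
  · rintro ⟨x, hx⟩
    have h1 : inner ℝ (y - x) (x - c) = 0 :=
      Submodule.mem_orthogonal_singleton_iff_inner_left.1 (hL x hx)
    have h2 := norm_add_sq_eq_norm_sq_add_norm_sq_of_inner_eq_zero _ _ h1
    rw [sub_add_sub_cancel, ← dist_eq_norm (x : EuclideanSpace ℝ (Fin (n + 1))) c,
      mem_sphere.1 x.2, ← dist_eq_norm] at h2
    nlinarith [dist_nonneg (x := y) (y := c), mul_self_nonneg ‖y - x‖]
  · intro hy
    rcases hy.eq_or_lt with hy | hy
    · exact ⟨⟨y, hy.symm⟩, by simp⟩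
    · have hmem : ∀ x : sphere (0 : EuclideanSpace ℝ (Fin (n + 1))) 1,
          c + R • (x : EuclideanSpace ℝ (Fin (n + 1))) ∈ sphere c R := fun x => by
        simp [norm_smul, hR.le]
      obtain ⟨x, hx⟩ := exists_sub_mem_of_tangent (φ := fun x => L.toFun ⟨_, hmem x⟩)
        (L.continuous_toFun.comp (by fun_prop)) (fun x u hu => by
          have h1 := Submodule.mem_orthogonal_singleton_iff_inner_left.1 (hL _ hu)
          rw [add_sub_cancel_left, inner_smul_right] at h1
          exact Submodule.mem_orthogonal_singleton_iff_inner_left.2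
            ((mul_eq_zero.1 h1).resolve_left hR.ne')) hR (z := y - c) (by rwa [← dist_eq_norm])
      exact ⟨_, by rw [sub_sub] at hx; exact hx⟩

theorem QuadraticForm.continuous_of_finiteDimensional {V : Type*} [NormedAddCommGroup V]
    [NormedSpace ℝ V] [FiniteDimensional ℝ V] (Q : QuadraticForm ℝ V) : Continuous Q := by
  have h : ∀ x, Q x = (QuadraticMap.associated Q).toContinuousBilinearMap x x := fun x =>
    (QuadraticMap.associated_eq_self_apply ℝ Q x).symm
  rw [show (Q : V → ℝ) = _ from funext h]
  fun_prop

end Sweep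

theorem theorem5p13 (n : ℕ) :
    (∀ (c : EuclideanSpace ℝ (Fin (n + 1))) (R : ℝ), 0 < R →
      ∀ L : EmbeddedLineBundle (Metric.sphere c R),
        (interior (codiagonal '' L.totalSpace)).Nonempty ∧
        (1 ≤ n → L.IsTangentToSphere →
          codiagonal '' L.totalSpace = (Metric.ball c R)ᶜ)) ∧
    (∀ X : Set (EuclideanSpace ℝ (Fin (n + 1))), IsEllipsoid X →
      ∀ L : EmbeddedLineBundle X,
        (interior (codiagonal '' L.totalSpace)).Nonempty) := by
  refine ⟨fun c R hR L => ⟨L.nonempty_interior_of_starlike continuous_const (fun _ => hR) c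
    fun x => by simp [norm_smul, hR.le], fun _ => L.codiagonal_image_of_tangent hR⟩, ?_⟩
  rintro X ⟨Q, c, r, hQ, hr, rfl⟩ L
  have hQ0 : ∀ x : Metric.sphere (0 : EuclideanSpace ℝ (Fin (n + 1))) 1, 0 < Q x := fun x =>
    hQ _ (ne_zero_of_mem_unit_sphere x)
  -- The ray from `c` in direction `x` meets the ellipsoid at the distance `ρ` with `ρ² Q(x) = r`.
  refine L.nonempty_interior_of_starlike
    (ρ := fun x => √(r / Q (x : EuclideanSpace ℝ (Fin (n + 1)))))
    ((continuous_const.div (Q.continuous_of_finiteDimensional.comp continuous_subtype_val)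
      fun x => (hQ0 x).ne').sqrt) (fun x => Real.sqrt_pos.2 (div_pos hr (hQ0 x))) c fun x => ?_
  simp only [Set.mem_ofPred_eq, add_sub_cancel_left, QuadraticMap.map_smul, smul_eq_mul]
  rw [Real.mul_self_sqrt (div_pos hr (hQ0 x)).le, div_mul_cancel₀ _ (hQ0 x).ne']
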